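/- Let $\Sigma$ be an alphabet and $a\in\Sigma$. A regular graph pattern (RGP) $P$ over $\Sigma$ is a digraph $D_P$ (loops allowed) together with a function $E_P$ that labels each arc $(x,y)$ of $D_P$ with a regular expression $E_P(x,y)$ over $\Sigma$. The label $E_Q(W)$ of a directed walk $W$ in an RGP $Q$ is the concatenation of the labels of its arcs. A navigational homomorphism (n-homomorphism) of $P$ to $Q$ is a map $f:V(D_P)\to V(D_Q)$ such that for each arc $(x,y)$ of $D_P$ there is a directed walk $W$ in $Q$ from $f(x)$ to $f(y)$ with $L(E_Q(W))\subseteq L(E_P(x,y))$. For a fixed RGP $Q$, the problem RGPHom($Q$) asks, given a finite RGP $P$, whether $P$ admits an n-homomorphism to $Q$. Write $a^+=a\cdot a^*$. The problem Parallel Job Scheduling With Relative Deadlines asks, given a finite set $J$ of jobs, a duration function $d:J\to\mathbb N$, a relative deadline function $r:J\times J\to\mathbb Z$ and a maximum time $t_{\max}\in\mathbb N$ (numbers written in binary), whether there is an assignment $t:J\to\mathbb N$ of start times such that $t(j)+d(j)\le t_{\max}$ for every job $j$, and $t(j_1)\le t(j_2)+r(j_1,j_2)$ for all jobs $j_1,j_2$.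 Theorem. Let $Q$ be an RGP whose underlying digraph is a directed path $q_0\to q_1\to\dots\to q_{n-1}$ ($n\ge 1$), and whose arc labels are all $a$. Then RGPHom($Q$), restricted to input RGPs with all arc labels in $\{a,a^+\}$, is reducible by a polynomial-time many-one reduction to Parallel Job Scheduling With Relative Deadlines. -/

import Mathlib

/-- A regular graph pattern over the alphabet `α` with vertex set `V`: a digraph together with a
function that labels every arc by a regular expression over `α`. -/
structure RGP (α : Type*) (V : Type*) where
  digraph : Digraph V
  label : ∀ x y : V, digraph.Adj x y → RegularExpression α

namespace RGP

variable {α V W : Type*}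

/-- Directed walks, i.e. sequences of consecutive arcs. -/
inductive Walk (P : RGP α V) : V → V → Type _
  | nil (x : V) : Walk P x x
  | cons {x y z : V} (h : P.digraph.Adj x y) (w : Walk P y z) : Walk P x z

/-- The label of a directed walk: the concatenation of the labels of its arcs. -/
def Walk.label {P : RGP α V} : {x y : V} → P.Walk x y → RegularExpression α
  | _, _, .nil _ => .epsilon
  | _, _, .cons (x := x) (y := y) h w => .comp (P.label x y h) w.label

/-- `f` is a navigational homomorphism of `P` to `Q`. -/
def IsNHom (P : RGP α V) (Q : RGP α W) (f : V → W) : Prop :=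
  ∀ (x y : V) (h : P.digraph.Adj x y),
    ∃ w : Q.Walk (f x) (f y), w.label.matches' ≤ (P.label x y h).matches'

/-- `P` admits a navigational homomorphism to `Q`. -/
def NHom (P : RGP α V) (Q : RGP α W) : Prop :=
  ∃ f : V → W, P.IsNHom Q f

/-- The regular expression `a⁺ = a · a*`. -/
def aPlus (a : α) : RegularExpression α :=
  .comp (.char a) (.star (.char a))

/-- All arc labels are `a`. -/
def LabelsEqA (P : RGP α V) (a : α) : Prop :=
  ∀ x y h, P.label x y h = .char a

/-- All arc labels belong to `{a, a⁺}`. -/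
def LabelsInAAPlus (P : RGP α V) (a : α) : Prop :=
  ∀ x y h, P.label x y h = .char a ∨ P.label x y h = aPlus a

end RGP

/-- The digraph `D` is a directed path `q₀ → q₁ → ⋯ → qₙ` (with `n + 1 ≥ 1` distinct vertices,
and no other arcs). -/
def Digraph.IsDirectedPath {V : Type*} (D : Digraph V) : Prop :=
  ∃ (n : ℕ) (q : Fin (n + 1) ≃ V),
    ∀ i j : Fin (n + 1), D.Adj (q i) (q j) ↔ (i : ℕ) + 1 = (j : ℕ)

/-- A decision problem: a type of instances, an injective encoding of the instances as words over
a finite alphabet, and the set of yes-instances. -/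
structure DecisionProblem where
  Instance : Type
  Symbol : Type
  finite_symbol : Finite Symbol
  encode : Instance → List Symbol
  encode_injective : Function.Injective encode
  yes : Instance → Prop

/-- Polynomial-time many-one reducibility: some map of instances, computed by a Turing machine in
time polynomial in the length of the encoding of the input, preserves and reflects
yes-instances. -/
def DecisionProblem.PolyTimeReducible (A B : DecisionProblem) : Prop :=
  ∃ f : A.Instance → B.Instance,
    Nonempty (Turing.TM2ComputableInPolyTime A.encode B.encode f) ∧
      ∀ I : A.Instance, A.yes I ↔ B.yes (f I)

/-- A list of blocks of the same shape is determined by its concatenation, if blocks can be split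
off from the left. -/
theorem flatMap_inj_of_split {ι Γ : Type*} (f g : ι → List Γ)
    (hsplit : ∀ i s t, f i ++ s = g i ++ t → f i = g i ∧ s = t) (l : List ι) :
    ∀ s t, l.flatMap f ++ s = l.flatMap g ++ t → (∀ i ∈ l, f i = g i) ∧ s = t := by
  induction l with
  | nil => intro s t h; simpa using h
  | cons i l ih =>
    intro s t h
    simp only [List.flatMap_cons, List.append_assoc] at h
    obtain ⟨h1, h2⟩ := hsplit i _ _ h
    obtain ⟨h3, h4⟩ := ih _ _ h2
    refine ⟨?_, h4⟩
    intro j hj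
    rcases List.mem_cons.1 hj with rfl | hj
    · exact h1
    · exact h3 j hj

/-! ### The homomorphism problem for instances with labels in `{a, a⁺}` -/

/-- The symbols used to write an RGP with arc labels in `{a, a⁺}` as a matrix. -/
inductive RGPSymbol
  | noArc
  | arcA
  | arcAPlus
  | endRow
  deriving DecidableEq

instance : Fintype RGPSymbol where
  elems := {.noArc, .arcA, .arcAPlus, .endRow}
  complete := by intro x; cases x <;> simp

/-- RGPs with arc labels in `{a, a⁺}` and vertex set `{0, …, m - 1}`, for any `m`. -/
structure RGPInstance {α : Type} (a : α) where
  m : ℕ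
  P : RGP α (Fin m)
  labels : P.LabelsInAAPlus a

namespace RGPInstance

variable {α : Type} {a : α}

open Classical in
/-- The entry of the labelled adjacency matrix at `(x, y)`. -/
noncomputable def entry (I : RGPInstance a) (x y : Fin I.m) : RGPSymbol :=
  if h : I.P.digraph.Adj x y then
    if I.P.label x y h = .char a then .arcA else .arcAPlus
  else .noArc

/-- The labelled adjacency matrix, written row by row. -/
noncomputable def encode (I : RGPInstance a) : List RGPSymbol :=
  (List.finRange I.m).flatMap fun x =>
    (List.finRange I.m).map (fun y => I.entry x y) ++ [.endRow]

theorem length_encode (I : RGPInstance a) : I.encode.length = I.m * (I.m + 1) := by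
  simp [encode, List.length_flatMap]

theorem encode_injective :
    Function.Injective (encode : RGPInstance a → List RGPSymbol) := by
  intro I J h
  have hm : I.m = J.m := by
    have hl := congrArg List.length h
    rw [length_encode, length_encode] at hl
    nlinarith [lt_trichotomy I.m J.m]
  obtain ⟨m, P, hP⟩ := I
  obtain ⟨m', P', hP'⟩ := J
  obtain rfl : m = m' := hm
  have h2 := (flatMap_inj_of_split
    (fun x => (List.finRange m).map (fun y => entry ⟨m, P, hP⟩ x y) ++ [.endRow])
    (fun x => (List.finRange m).map (fun y => entry ⟨m, P', hP'⟩ x y) ++ [.endRow])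
    (fun i s t hst => List.append_inj hst (by simp))
    (List.finRange m) [] [] (by simpa [encode] using h)).1
  have h3 : ∀ x y, entry ⟨m, P, hP⟩ x y = entry ⟨m, P', hP'⟩ x y := by
    intro x y
    have := h2 x (List.mem_finRange x)
    have := List.append_cancel_right this
    exact (List.map_inj_left.1 this) y (List.mem_finRange y)
  have hne : (RegularExpression.char a) ≠ RGP.aPlus a := by
    intro h
    cases h
  obtain ⟨D, E⟩ := P
  obtain ⟨D', E'⟩ := P'
  have hD : D = D' := by
    ext x y
    have := h3 x y
    simp only [entry] at this
    split_ifs at this <;> simp_all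
  subst hD
  have hE : E = E' := by
    funext x y hxy
    have := h3 x y
    have h5 := hP x y hxy
    have h6 := hP' x y hxy
    simp only [entry, hxy, dite_true] at this h5 h6
    rcases h5 with h5 | h5 <;> rcases h6 with h6 | h6 <;>
      simp_all [hne.symm]
  subst hE
  rfl

end RGPInstance

/-- The problem RGPHom(`Q`) for instances with arc labels in `{a, a⁺}`. -/
noncomputable def RGPHomProblem {α : Type} (a : α) {W : Type*} (Q : RGP α W) :
    DecisionProblem where
  Instance := RGPInstance a
  Symbol := RGPSymbol
  finite_symbol := inferInstance
  encode := RGPInstance.encode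
  encode_injective := RGPInstance.encode_injective
  yes I := I.P.NHom Q

/-! ### Parallel job scheduling with relative deadlines -/

/-- An instance of the scheduling problem, with job set `{0, …, k - 1}`. -/
structure SchedulingInstance where
  k : ℕ
  duration : Fin k → ℕ
  relDeadline : Fin k → Fin k → ℤ
  tMax : ℕ

namespace SchedulingInstance

/-- A feasible assignment of start times: every job is finished by time `tMax`, and the job `i`
is started no later than `relDeadline i j` time units after the start of the job `j`. -/
def IsFeasible (S : SchedulingInstance) (t : Fin S.k → ℕ) : Prop :=
  (∀ j, t j + S.duration j ≤ S.tMax) ∧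
    ∀ i j, (t i : ℤ) ≤ (t j : ℤ) + S.relDeadline i j

end SchedulingInstance

/-- The symbols used to write instances of the scheduling problem. -/
inductive SchedulingSymbol
  | bit (b : Bool)
  | minus
  | comma
  | endRow
  deriving DecidableEq

instance : Fintype SchedulingSymbol where
  elems := {.bit false, .bit true, .minus, .comma, .endRow}
  complete := by
    intro x
    rcases x with b | _ | _ | _ <;> [cases b; skip; skip; skip] <;> simp

namespace SchedulingSymbol

/-- A natural number in binary (least significant bit first), followed by a comma. -/
def encodeNat (n : ℕ) : List SchedulingSymbol :=
  (Computability.encodeNat n).map bit ++ [comma]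

/-- An integer in binary, with a minus sign in front if it is negative, followed by a comma. -/
def encodeInt (z : ℤ) : List SchedulingSymbol :=
  (if z < 0 then [minus] else []) ++ encodeNat z.natAbs

theorem encodeNat_split (n n' : ℕ) (s t : List SchedulingSymbol)
    (h : encodeNat n ++ s = encodeNat n' ++ t) : n = n' ∧ s = t := by
  have key : ∀ (l l' : List Bool),
      l.map bit ++ ([comma] ++ s) = l'.map bit ++ ([comma] ++ t) → l = l' ∧ s = t := by
    intro l
    induction l with
    | nil => intro l' h; cases l' <;> simp_all
    | cons b l ih =>
      intro l' h
      cases l' with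
      | nil => simp at h
      | cons b' l' =>
        simp only [List.map_cons, List.cons_append, List.cons.injEq, bit.injEq] at h
        obtain ⟨h1, h2⟩ := ih l' h.2
        exact ⟨by rw [h.1, h1], h2⟩
  obtain ⟨h1, h2⟩ := key _ _ (by simpa [encodeNat] using h)
  refine ⟨?_, h2⟩
  have := congrArg Computability.decodeNat h1
  simpa using this

theorem encodeInt_split (z z' : ℤ) (s t : List SchedulingSymbol)
    (h : encodeInt z ++ s = encodeInt z' ++ t) : z = z' ∧ s = t := by
  have hne : ∀ (n : ℕ) (u v : List SchedulingSymbol), encodeNat n ++ u ≠ minus :: v := by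
    intro n u v
    unfold encodeNat
    cases Computability.encodeNat n <;> simp
  unfold encodeInt at h
  by_cases hz : z < 0 <;> by_cases hz' : z' < 0
  · simp only [hz, hz', if_true, List.cons_append, List.nil_append, List.cons.injEq,
      true_and] at h
    obtain ⟨h1, h2⟩ := encodeNat_split _ _ _ _ h
    exact ⟨by omega, h2⟩
  · simp only [hz, hz', if_true, if_false, List.cons_append, List.nil_append] at h
    exact absurd h.symm (hne _ _ _)
  · simp only [hz, hz', if_true, if_false, List.cons_append, List.nil_append] at h
    exact absurd h (hne _ _ _)
  · simp only [hz, hz', if_false, List.nil_append] at h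
    obtain ⟨h1, h2⟩ := encodeNat_split _ _ _ _ h
    exact ⟨by omega, h2⟩

theorem count_endRow_encodeNat (n : ℕ) : (encodeNat n).count endRow = 0 := by
  simp [encodeNat, List.count_eq_zero]

theorem count_endRow_encodeInt (z : ℤ) : (encodeInt z).count endRow = 0 := by
  unfold encodeInt
  split_ifs <;> simp [count_endRow_encodeNat]

end SchedulingSymbol

namespace SchedulingInstance

open SchedulingSymbol

/-- The row of a job `i`: its duration, and its deadlines relative to the jobs `0, …, k - 1`. -/
def encodeRow (S : SchedulingInstance) (i : Fin S.k) : List SchedulingSymbol :=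
  encodeNat (S.duration i) ++
    (List.finRange S.k).flatMap (fun j => encodeInt (S.relDeadline i j)) ++ [endRow]

/-- The maximum time, followed by the rows of all jobs. -/
def encode (S : SchedulingInstance) : List SchedulingSymbol :=
  encodeNat S.tMax ++ (List.finRange S.k).flatMap S.encodeRow

theorem count_endRow_encode (S : SchedulingInstance) : S.encode.count endRow = S.k := by
  simp [encode, encodeRow, List.count_flatMap, Function.comp_def, count_endRow_encodeNat,
    count_endRow_encodeInt]

theorem encode_injective : Function.Injective encode := by
  intro S T h
  have hk : S.k = T.k := by
    rw [← count_endRow_encode S, ← count_endRow_encode T, h]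
  obtain ⟨k, d, r, tm⟩ := S
  obtain ⟨k', d', r', tm'⟩ := T
  obtain rfl : k = k' := hk
  obtain ⟨h1, h2⟩ := encodeNat_split _ _ _ _ h
  have hrow : ∀ i s t, encodeRow ⟨k, d, r, tm⟩ i ++ s = encodeRow ⟨k, d', r', tm'⟩ i ++ t →
      (d i = d' i ∧ ∀ j, r i j = r' i j) ∧ s = t := by
    intro i s t hst
    simp only [encodeRow, List.append_assoc] at hst
    obtain ⟨e1, e2⟩ := encodeNat_split _ _ _ _ hst
    obtain ⟨e3, e4⟩ := flatMap_inj_of_split _ _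
      (fun j s t hst => by
        obtain ⟨a1, a2⟩ := encodeInt_split _ _ _ _ hst
        exact ⟨by rw [a1], a2⟩) _ _ _ e2
    refine ⟨⟨e1, fun j => ?_⟩, by simpa using e4⟩
    exact (encodeInt_split _ _ [] [] (by rw [e3 j (List.mem_finRange j)])).1
  have h3 := (flatMap_inj_of_split _ _
      (fun i s t hst => by
        obtain ⟨⟨b1, b2⟩, b3⟩ := hrow i s t hst
        exact ⟨by simp only [encodeRow, b1, b2], b3⟩) (List.finRange k) [] []
      (by simpa using h2)).1
  have h4 := fun i => (hrow i [] [] (by rw [h3 i (List.mem_finRange i)])).1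
  obtain rfl : d = d' := funext fun i => (h4 i).1
  obtain rfl : r = r' := funext fun i => funext fun j => (h4 i).2 j
  obtain rfl : tm = tm' := h1
  rfl

end SchedulingInstance

/-- The problem Parallel Job Scheduling With Relative Deadlines. -/
def SchedulingProblem : DecisionProblem where
  Instance := SchedulingInstance
  Symbol := SchedulingSymbol
  finite_symbol := inferInstance
  encode := SchedulingInstance.encode
  encode_injective := SchedulingInstance.encode_injective
  yes S := ∃ t, S.IsFeasible t

/-! ### Navigational homomorphisms to a directed path -/

/-! In a directed path every arc raises the index by one, so a walk from `q i` to `q j` exists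
exactly when `i ≤ j`, and its length is then `j - i`. As all its labels are `a`, its language is the
single word of that length. Hence an arc labelled `a` forces the index to grow by exactly one, an
arc labelled `a⁺` by at least one, and a homomorphism is a solution in `{0, …, n}` of a system of
difference constraints (`RGPInstance.nHom_iff`). Such a system is a scheduling instance with unit
jobs (`RGPInstance.nHom_iff_feasible`). The deadline for `(x, y)` depends on the entries at `(x, y)`
and `(y, x)`, so the machine must read the matrix and its transpose in parallel. It builds the
transpose by stripping one column per sweep (`reaches_transpose`), then pops both backwards, so that
the output stack ends in reading order (`reaches_outRow`). As `n` is fixed, only constant words are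
written, and the running time is quadratic in the input length. -/

namespace RGP

variable {α V W : Type*}

/-- The number of arcs of a directed walk. -/
def Walk.length {P : RGP α V} : {x y : V} → P.Walk x y → ℕ
  | _, _, .nil _ => 0
  | _, _, .cons _ w => w.length + 1

theorem Walk.matches'_label {Q : RGP α W} {a : α} (hQ : Q.LabelsEqA a) {x y : W}
    (w : Q.Walk x y) : w.label.matches' = {List.replicate w.length a} := by
  induction w with
  | nil x => rfl
  | cons h w ih =>
    change (Q.label _ _ h).matches' * w.label.matches' = _
    rw [ih, hQ, RegularExpression.matches'_char]
    change Set.image2 (· ++ ·) {[a]} {List.replicate w.length a} = _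
    rw [Set.image2_singleton]
    rfl

theorem replicate_mem_matches'_char (a : α) (k : ℕ) :
    List.replicate k a ∈ (RegularExpression.char a).matches' ↔ k = 1 := by
  rw [RegularExpression.matches'_char]
  change List.replicate k a = [a] ↔ _
  constructor
  · intro h; simpa using congrArg List.length h
  · rintro rfl; rfl

theorem replicate_mem_matches'_aPlus (a : α) (k : ℕ) :
    List.replicate k a ∈ (aPlus a).matches' ↔ 1 ≤ k := by
  change List.replicate k a ∈
    (RegularExpression.char a).matches' * KStar.kstar (RegularExpression.char a).matches' ↔ _
  rw [RegularExpression.matches'_char, Language.mem_mul]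
  constructor
  · rintro ⟨u, hu, v, -, h⟩
    obtain rfl : u = [a] := hu
    have := congrArg List.length h
    simp at this
    omega
  · intro hk
    obtain ⟨j, rfl⟩ := Nat.exists_eq_add_of_le' hk
    refine ⟨[a], rfl, List.replicate j a, ?_, rfl⟩
    refine Language.mem_kstar.2 ⟨List.replicate j [a], ?_, ?_⟩
    · simp
    · intro y hy
      exact List.eq_of_mem_replicate hy

theorem Walk.val_add_length {Q : RGP α W} {n : ℕ} {q : Fin (n + 1) ≃ W}
    (hq : ∀ i j, Q.digraph.Adj (q i) (q j) ↔ (i : ℕ) + 1 = j) {x y : W} (w : Q.Walk x y) :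
    (q.symm x : ℕ) + w.length = q.symm y := by
  induction w with
  | nil x => rfl
  | @cons x y z h w ih =>
    have h1 := (hq (q.symm x) (q.symm y)).1 (by simpa using h)
    simp only [Walk.length]
    omega

theorem exists_walk_of_val_add_eq {Q : RGP α W} {n : ℕ} {q : Fin (n + 1) ≃ W}
    (hq : ∀ i j, Q.digraph.Adj (q i) (q j) ↔ (i : ℕ) + 1 = j) (k : ℕ) :
    ∀ i j : Fin (n + 1), (i : ℕ) + k = j → ∃ w : Q.Walk (q i) (q j), w.length = k := by
  induction k with
  | zero =>
    intro i j h
    obtain rfl : i = j := Fin.ext h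
    exact ⟨.nil _, rfl⟩
  | succ k ih =>
    intro i j h
    have := j.isLt
    obtain ⟨w, hw⟩ := ih ⟨i + 1, by omega⟩ j (by simp only; omega)
    exact ⟨.cons ((hq i ⟨i + 1, by omega⟩).2 rfl) w, by simp [Walk.length, hw]⟩

/-- The language of a walk is a singleton determined by its length, so inclusion of languages
becomes membership of one word, and walks can be replaced by their lengths. -/
theorem exists_walk_matches'_le_iff {Q : RGP α W} {a : α} (hQ : Q.LabelsEqA a) {n : ℕ}
    {q : Fin (n + 1) ≃ W} (hq : ∀ i j, Q.digraph.Adj (q i) (q j) ↔ (i : ℕ) + 1 = j)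
    (i j : Fin (n + 1)) (E : RegularExpression α) :
    (∃ w : Q.Walk (q i) (q j), w.label.matches' ≤ E.matches') ↔
      ∃ k, (i : ℕ) + k = j ∧ List.replicate k a ∈ E.matches' := by
  constructor
  · rintro ⟨w, hw⟩
    rw [w.matches'_label hQ] at hw
    exact ⟨w.length, by simpa using w.val_add_length hq, hw rfl⟩
  · rintro ⟨k, hk, h⟩
    obtain ⟨w, rfl⟩ := exists_walk_of_val_add_eq hq k i j hk
    refine ⟨w, ?_⟩
    rw [w.matches'_label hQ]
    exact Set.singleton_subset_iff.2 h

end RGP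

/-! ### Homomorphisms as solutions of difference constraints -/

namespace RGPInstance

variable {α : Type} {a : α}

theorem entry_ne_endRow (I : RGPInstance a) (x y : Fin I.m) : I.entry x y ≠ .endRow := by
  unfold entry
  split_ifs <;> simp

/-- A map to a path with vertices `0, …, n` is a navigational homomorphism if and only if it
increases along every arc, and increases by exactly one along every arc labelled `a`. -/
theorem nHom_iff (I : RGPInstance a) {W : Type*} {Q : RGP α W} (hQ : Q.LabelsEqA a) {n : ℕ}
    {q : Fin (n + 1) ≃ W} (hq : ∀ i j, Q.digraph.Adj (q i) (q j) ↔ (i : ℕ) + 1 = j) :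
    I.P.NHom Q ↔ ∃ t : Fin I.m → ℕ, (∀ x, t x ≤ n) ∧ ∀ x y,
      (I.entry x y ≠ .noArc → t x + 1 ≤ t y) ∧ (I.entry x y = .arcA → t y ≤ t x + 1) := by
  have key : ∀ (x y : Fin I.m) (i j : Fin (n + 1)),
      (∀ h : I.P.digraph.Adj x y,
        ∃ w : Q.Walk (q i) (q j), w.label.matches' ≤ (I.P.label x y h).matches') ↔
      (I.entry x y ≠ .noArc → (i : ℕ) + 1 ≤ j) ∧ (I.entry x y = .arcA → (j : ℕ) ≤ i + 1) := by
    intro x y i j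
    by_cases h : I.P.digraph.Adj x y
    · have hne : RGP.aPlus a ≠ RegularExpression.char a := nofun
      simp only [h, forall_true_left, RGP.exists_walk_matches'_le_iff hQ hq, entry, dif_pos]
      rcases I.labels x y h with hl | hl
      · simp only [hl, RGP.replicate_mem_matches'_char, if_true]
        constructor
        · rintro ⟨k, hk, rfl⟩
          simp [hk]
        · intro ⟨h1, h2⟩
          have := h1 (by simp)
          have := h2 trivial
          exact ⟨1, by omega, rfl⟩
      · simp only [hl, RGP.replicate_mem_matches'_aPlus, hne, if_false]
        constructor
        · rintro ⟨k, hk, hk1⟩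
          exact ⟨fun _ => by omega, nofun⟩
        · intro ⟨h1, _⟩
          have := h1 (by simp)
          exact ⟨j - i, by omega, by omega⟩
    · simp [h, entry]
  constructor
  · rintro ⟨f, hf⟩
    obtain ⟨g, rfl⟩ : ∃ g, f = fun x => q (g x) :=
      ⟨fun x => q.symm (f x), funext fun x => (q.apply_symm_apply (f x)).symm⟩
    exact ⟨fun x => g x, fun x => Nat.le_of_lt_succ (g x).isLt,
      fun x y => (key x y _ _).1 fun h => hf x y h⟩
  · rintro ⟨t, ht, htt⟩
    exact ⟨fun x => q ⟨t x, by have := ht x; omega⟩, fun x y h => (key x y _ _).2 (htt x y) h⟩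

end RGPInstance

/-! ### The scheduling instance of a graph pattern -/

/-- The relative deadline of the job `x` with respect to the job `y`, given the labels of the
arcs `(x, y)` and `(y, x)`, if the target is a directed path of length `n`. -/
def RGPSymbol.deadline (n : ℕ) (s s' : RGPSymbol) : ℤ :=
  if s ≠ .noArc then -1 else if s' = .arcA then 1 else n

/-- The scheduling instance with one job of duration `1` for every vertex. -/
noncomputable def RGPInstance.toScheduling {α : Type} {a : α} (n : ℕ) (I : RGPInstance a) :
    SchedulingInstance where
  k := I.m
  duration _ := 1
  relDeadline x y := RGPSymbol.deadline n (I.entry x y) (I.entry y x)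
  tMax := n + 1

/-- Unit durations and `tMax = n + 1` say that start times are at most `n`. The deadline `-1`
encodes growth along an arc, and `1` the upper bound imposed by a reversed arc labelled `a`. If both
arcs are present, `-1` already implies that upper bound. A loop gives `t x ≤ t x - 1`, infeasible as
it should be. -/
theorem RGPInstance.nHom_iff_feasible {α : Type} {a : α} (I : RGPInstance a) {W : Type*}
    {Q : RGP α W} (hQ : Q.LabelsEqA a) {n : ℕ} {q : Fin (n + 1) ≃ W}
    (hq : ∀ i j, Q.digraph.Adj (q i) (q j) ↔ (i : ℕ) + 1 = j) :
    I.P.NHom Q ↔ ∃ t, (I.toScheduling n).IsFeasible t := by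
  rw [I.nHom_iff hQ hq]
  constructor
  · rintro ⟨t, ht, h⟩
    refine ⟨t, fun x => Nat.succ_le_succ (ht x), fun x y => ?_⟩
    change (t x : ℤ) ≤ t y + RGPSymbol.deadline n (I.entry x y) (I.entry y x)
    have h1 := (h x y).1
    have h2 := (h y x).2
    have := ht x
    unfold RGPSymbol.deadline
    split_ifs with h3 h4
    · have := h1 h3
      omega
    · have := h2 h4
      omega
    -- The default deadline `n` is vacuous, since all start times lie between `0` and `n`.
    · omega
  · rintro ⟨t, ht, h⟩
    change ∀ x y, (t x : ℤ) ≤ t y + RGPSymbol.deadline n (I.entry x y) (I.entry y x) at h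
    refine ⟨t, fun x => Nat.le_of_succ_le_succ (ht x), fun x y => ⟨fun hxy => ?_, fun hxy => ?_⟩⟩
    · have := h x y
      rw [RGPSymbol.deadline, if_pos hxy] at this
      omega
    · have := h y x
      unfold RGPSymbol.deadline at this
      split_ifs at this <;> omega

/-! ### The machine computing the reduction -/

namespace ReductionMachine

open Turing Turing.TM2 RGPSymbol

/-- The stacks: the input, a buffer, the symbols of the matrix in reversed column order and in
reversed row order, and the output. -/
inductive Stack
  | inp
  | buf
  | col
  | row
  | out
  deriving DecidableEq

instance : Fintype Stack where
  elems := {.inp, .buf, .col, .row, .out}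
  complete := by intro x; cases x <;> simp

/-- The labels of the program. -/
inductive Label
  | copy
  | back
  | rowHead
  | rowTail
  | check
  | outRow
  | outEntry
  deriving DecidableEq

instance : Fintype Label where
  elems := {.copy, .back, .rowHead, .rowTail, .check, .outRow, .outEntry}
  complete := by intro x; cases x <;> simp

/-- The alphabets of the stacks. -/
abbrev Alphabet : Stack → Type
  | .out => SchedulingSymbol
  | _ => RGPSymbol

/-- The registers of the machine hold up to two symbols read from the stacks. -/
abbrev Reg : Type := Option RGPSymbol × Option RGPSymbol

/-- Push a fixed word on the output, its first symbol first. -/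
def pushWord : List SchedulingSymbol → Stmt Alphabet Label Reg → Stmt Alphabet Label Reg
  | [], q => q
  | s :: l, q => .push Stack.out (fun _ => s) (pushWord l q)

/-- Pop a symbol from the input into the first register. -/
def popInp (q : Stmt Alphabet Label Reg) : Stmt Alphabet Label Reg :=
  .pop Stack.inp (fun v s => (s, v.2)) q

/-- Pop a symbol from the buffer into the first register. -/
def popBuf (q : Stmt Alphabet Label Reg) : Stmt Alphabet Label Reg :=
  .pop Stack.buf (fun v s => (s, v.2)) q

/-- Push the first register on the buffer. -/
def pushBuf (q : Stmt Alphabet Label Reg) : Stmt Alphabet Label Reg :=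
  .push Stack.buf (fun v => v.1.getD .noArc) q

/-- The program. The label `copy` moves the input to the buffer, with a copy on `row`. The label
`back` moves the buffer to the input. The labels `rowHead` and `rowTail` move the input to the
buffer, but the head of every row to `col`, without the rows that are empty. This is
repeated until `check` finds an empty buffer, when `col` holds the transposed matrix. The labels
`outRow` and `outEntry` read the matrix and its transpose backwards to write the output. -/
def program (n : ℕ) : Label → Stmt Alphabet Label Reg
  | .copy => popInp <| .branch (fun v => v.1.isNone) (.goto fun _ => .back) <|
      .push Stack.row (fun v => v.1.getD .noArc) <| pushBuf <| .goto fun _ => .copy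
  | .back => popBuf <| .branch (fun v => v.1.isNone) (.goto fun _ => .rowHead) <|
      .push Stack.inp (fun v => v.1.getD .noArc) <| .goto fun _ => .back
  | .rowHead => popInp <| .branch (fun v => v.1.isNone) (.goto fun _ => .check) <|
      .branch (fun v => v.1 = some .endRow) (.goto fun _ => .rowHead) <|
      .push Stack.col (fun v => v.1.getD .noArc) <| .goto fun _ => .rowTail
  | .rowTail => popInp <| pushBuf <|
      .branch (fun v => v.1 = some .endRow) (.goto fun _ => .rowHead) (.goto fun _ => .rowTail)
  | .check => popBuf <| .branch (fun v => v.1.isNone) (.goto fun _ => .outRow) <|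
      .push Stack.inp (fun v => v.1.getD .noArc) <| .goto fun _ => .back
  | .outRow => .pop Stack.row (fun v s => (s, v.2)) <| .branch (fun v => v.1.isNone)
      (pushWord (SchedulingSymbol.encodeNat (n + 1)).reverse <| .load (fun _ => (none, none)) .halt)
      (.push Stack.out (fun _ => .endRow) <| .goto fun _ => .outEntry)
  | .outEntry => .peek Stack.row (fun v s => (s, v.2)) <|
      .branch (fun v => v.1 = none || v.1 = some .endRow)
        (pushWord (SchedulingSymbol.encodeNat 1).reverse <| .goto fun _ => .outRow) <|
      .pop Stack.row (fun v _ => v) <| .pop Stack.col (fun v s => (v.1, s)) <|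
      .branch (fun v => v.1 ≠ some .noArc)
        (pushWord (SchedulingSymbol.encodeInt (-1)).reverse <| .goto fun _ => .outEntry) <|
      .branch (fun v => v.2 = some .arcA)
        (pushWord (SchedulingSymbol.encodeInt 1).reverse <| .goto fun _ => .outEntry)
        (pushWord (SchedulingSymbol.encodeInt n).reverse <| .goto fun _ => .outEntry)

/-! ### Stack configurations and reachability with time bounds -/

/-- The contents of all stacks. -/
def contents (A B C D : List RGPSymbol) (O : List SchedulingSymbol) : ∀ k, List (Alphabet k)
  | .inp => A
  | .buf => B
  | .col => C
  | .row => D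
  | .out => O

section update

variable (A B C D : List RGPSymbol) (O : List SchedulingSymbol)

@[simp] theorem contents_inp : contents A B C D O .inp = A := rfl
@[simp] theorem contents_buf : contents A B C D O .buf = B := rfl
@[simp] theorem contents_col : contents A B C D O .col = C := rfl
@[simp] theorem contents_row : contents A B C D O .row = D := rfl
@[simp] theorem contents_out : contents A B C D O .out = O := rfl

@[simp] theorem update_inp (X : List RGPSymbol) :
    Function.update (contents A B C D O) .inp X = contents X B C D O := by
  funext k; cases k <;> rfl

@[simp] theorem update_buf (X : List RGPSymbol) :
    Function.update (contents A B C D O) .buf X = contents A X C D O := by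
  funext k; cases k <;> rfl

@[simp] theorem update_col (X : List RGPSymbol) :
    Function.update (contents A B C D O) .col X = contents A B X D O := by
  funext k; cases k <;> rfl

@[simp] theorem update_row (X : List RGPSymbol) :
    Function.update (contents A B C D O) .row X = contents A B C X O := by
  funext k; cases k <;> rfl

@[simp] theorem update_out (X : List SchedulingSymbol) :
    Function.update (contents A B C D O) .out X = contents A B C D X := by
  funext k; cases k <;> rfl

-- A whole word is pushed within one machine step, so its length does not enter the time bounds.
@[simp] theorem stepAux_pushWord (l : List SchedulingSymbol) (q : Stmt Alphabet Label Reg)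
    (v : Reg) :
    stepAux (pushWord l q) v (contents A B C D O) =
      stepAux q v (contents A B C D (l.reverse ++ O)) := by
  induction l generalizing O with
  | nil => rfl
  | cons s l ih => simp [pushWord, ih]

end update

/-- From the label `L` and the stacks `S`, whatever the registers contain, the label `L'` and the
stacks `S'` are reached in at most `t` steps. -/
def Reaches (n t : ℕ) (L : Label) (S : ∀ k, List (Alphabet k)) (L' : Label)
    (S' : ∀ k, List (Alphabet k)) : Prop :=
  ∀ v : Reg, ∃ v' : Reg, ∃ k ≤ t,
    (flip bind (step (program n)))^[k] (some ⟨some L, v, S⟩) = some ⟨some L', v', S'⟩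

variable {n : ℕ}

theorem Reaches.refl (L : Label) (S : ∀ k, List (Alphabet k)) : Reaches n 0 L S L S :=
  fun v => ⟨v, 0, le_rfl, rfl⟩

theorem Reaches.trans {s t : ℕ} {L₁ L₂ L₃ : Label} {S₁ S₂ S₃ : ∀ k, List (Alphabet k)}
    (h₁ : Reaches n s L₁ S₁ L₂ S₂) (h₂ : Reaches n t L₂ S₂ L₃ S₃) :
    Reaches n (s + t) L₁ S₁ L₃ S₃ := by
  intro v
  obtain ⟨v₁, k₁, hk₁, e₁⟩ := h₁ v
  obtain ⟨v₂, k₂, hk₂, e₂⟩ := h₂ v₁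
  exact ⟨v₂, k₂ + k₁, by omega, by rw [Function.iterate_add_apply, e₁, e₂]⟩

theorem Reaches.mono {s t : ℕ} {L₁ L₂ : Label} {S₁ S₂ : ∀ k, List (Alphabet k)}
    (h : Reaches n s L₁ S₁ L₂ S₂) (hst : s ≤ t) : Reaches n t L₁ S₁ L₂ S₂ := by
  intro v
  obtain ⟨v', k, hk, e⟩ := h v
  exact ⟨v', k, hk.trans hst, e⟩

theorem Reaches.of_stepAux {L L' : Label} {S S' : ∀ k, List (Alphabet k)}
    (h : ∀ v, ∃ v', stepAux (program n L) v S = ⟨some L', v', S'⟩) : Reaches n 1 L S L' S' := by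
  intro v
  obtain ⟨v', e⟩ := h v
  exact ⟨v', 1, le_rfl, congrArg some e⟩

variable (A B C D : List RGPSymbol) (O : List SchedulingSymbol)

theorem reaches_copy : Reaches n (A.length + 1) .copy (contents A B C D O) .back
    (contents [] (A.reverse ++ B) C (A.reverse ++ D) O) := by
  induction A generalizing B D with
  | nil => exact .of_stepAux fun v => ⟨(none, v.2), by simp [program, popInp]⟩
  | cons s A ih =>
    have h : Reaches n 1 .copy (contents (s :: A) B C D O) .copy
        (contents A (s :: B) C (s :: D) O) :=
      .of_stepAux fun v => ⟨(some s, v.2), by simp [program, popInp, pushBuf]⟩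
    simpa [add_comm] using h.trans (ih (s :: B) (s :: D))

theorem reaches_back : Reaches n (B.length + 1) .back (contents A B C D O) .rowHead
    (contents (B.reverse ++ A) [] C D O) := by
  induction B generalizing A with
  | nil => exact .of_stepAux fun v => ⟨(none, v.2), by simp [program, popBuf]⟩
  | cons s B ih =>
    have h : Reaches n 1 .back (contents A (s :: B) C D O) .back (contents (s :: A) B C D O) :=
      .of_stepAux fun v => ⟨(some s, v.2), by simp [program, popBuf]⟩
    simpa [add_comm] using h.trans (ih (s :: A))

theorem reaches_rowTail (w : List RGPSymbol) (hw : ∀ s ∈ w, s ≠ .endRow) :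
    Reaches n (w.length + 1) .rowTail (contents (w ++ .endRow :: A) B C D O) .rowHead
      (contents A (.endRow :: (w.reverse ++ B)) C D O) := by
  induction w generalizing B with
  | nil => exact .of_stepAux fun v => ⟨(some .endRow, v.2), by simp [program, popInp, pushBuf]⟩
  | cons s w ih =>
    have hs : s ≠ .endRow := hw s (by simp)
    have h : Reaches n 1 .rowTail (contents (s :: (w ++ .endRow :: A)) B C D O) .rowTail
        (contents (w ++ .endRow :: A) (s :: B) C D O) :=
      .of_stepAux fun v => ⟨(some s, v.2), by simp [program, popInp, pushBuf, hs]⟩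
    simpa [add_comm] using h.trans (ih (s :: B) fun s hs => hw s (by simp [hs]))

/-- The symbol popped for the emptiness test is moved to the input, exactly as `back` would do, so
the test costs no extra step. -/
theorem reaches_check (hB : B ≠ []) : Reaches n (B.length + 1) .check (contents A B C D O) .rowHead
    (contents (B.reverse ++ A) [] C D O) := by
  obtain ⟨s, B, rfl⟩ := List.exists_cons_of_ne_nil hB
  have h : Reaches n 1 .check (contents A (s :: B) C D O) .back (contents (s :: A) B C D O) :=
    .of_stepAux fun v => ⟨(some s, v.2), by simp [program, popBuf]⟩
  simpa [add_comm] using h.trans (reaches_back (s :: A) B C D O)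

/-! ### Transposing the matrix and writing the output -/

section matrix

variable {ι : Type*} (e : ι → ι → RGPSymbol)

/-- The matrix with entries `e x y`, for `x` in `X` and `y` in `l`, written row by row. -/
def rows (X l : List ι) : List RGPSymbol :=
  X.flatMap fun x => l.map (e x) ++ [.endRow]

@[simp] theorem rows_nil (l : List ι) : rows e [] l = [] := rfl

theorem rows_cons (x : ι) (X l : List ι) :
    rows e (x :: X) l = l.map (e x) ++ .endRow :: rows e X l := by
  simp [rows]

theorem rows_concat (x : ι) (X l : List ι) :
    rows e (X ++ [x]) l = rows e X l ++ (l.map (e x) ++ [.endRow]) := by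
  simp [rows]

theorem length_rows (X l : List ι) : (rows e X l).length = X.length * (l.length + 1) := by
  simp [rows, List.length_flatMap]

variable {e} (he : ∀ x y, e x y ≠ .endRow)
include he

/-- One sweep strips the first column. The remaining rows arrive reversed on the buffer; moving them
back to the input restores their order. -/
theorem reaches_rowHead_cons (X l : List ι) (y : ι) :
    Reaches n ((rows e X (y :: l)).length + 1) .rowHead (contents (rows e X (y :: l)) B C D O)
      .check (contents [] ((rows e X l).reverse ++ B) ((X.map (e · y)).reverse ++ C) D O) := by
  induction X generalizing B C with
  | nil => exact .of_stepAux fun v => ⟨(none, v.2), by simp [program, popInp]⟩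
  | cons x X ih =>
    rw [rows_cons, rows_cons]
    have h : Reaches n 1 .rowHead
        (contents (e x y :: (l.map (e x) ++ .endRow :: rows e X (y :: l))) B C D O) .rowTail
        (contents (l.map (e x) ++ .endRow :: rows e X (y :: l)) B (e x y :: C) D O) :=
      .of_stepAux fun v => ⟨(some (e x y), v.2), by simp [program, popInp, he]⟩
    have h' := (h.trans (reaches_rowTail _ _ _ _ _ (l.map (e x)) (by simp [he]))).trans (ih _ _)
    simp only [List.map_cons, List.cons_append, List.reverse_append, List.reverse_cons,
      List.append_assoc, List.nil_append] at h' ⊢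
    refine h'.mono ?_
    simp
    omega

omit he in
-- Exhausted rows consist of `endRow` alone and are discarded, so an empty buffer signals that no
-- column is left.
theorem reaches_rowHead_nil (X : List ι) :
    Reaches n (X.length + 1) .rowHead (contents (rows e X []) B C D O)
      .check (contents [] B C D O) := by
  induction X with
  | nil => exact .of_stepAux fun v => ⟨(none, v.2), by simp [program, popInp]⟩
  | cons x X ih =>
    have h : Reaches n 1 .rowHead (contents (.endRow :: rows e X []) B C D O) .rowHead
        (contents (rows e X []) B C D O) :=
      .of_stepAux fun v => ⟨(some .endRow, v.2), by simp [program, popInp]⟩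
    simpa [add_comm, rows_cons] using h.trans ih

/-- The bound `N` on the matrix size persists as columns are removed. Each column costs a sweep and
a return of at most `N + 1` steps each; the final sweep over empty rows and the last `check` cost at
most `N + 2`. The hypothesis `hX` makes the buffer nonempty while columns remain to be counted in
the induction. -/
theorem reaches_transpose (X l : List ι) (hX : X = [] → l = []) (N : ℕ)
    (hN : X.length * (l.length + 1) ≤ N) :
    Reaches n (l.length * (2 * N + 2) + (N + 2)) .rowHead (contents (rows e X l) [] C D O)
      .outRow (contents [] [] ((l.flatMap fun y => X.map (e · y)).reverse ++ C) D O) := by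
  induction l generalizing C with
  | nil =>
    have h : Reaches n 1 .check (contents [] [] C D O) .outRow (contents [] [] C D O) :=
      .of_stepAux fun v => ⟨(none, v.2), by simp [program, popBuf]⟩
    refine ((reaches_rowHead_nil [] C D O X).trans h).mono ?_
    simp at hN ⊢
    omega
  | cons y l ih =>
    have hX' : X ≠ [] := fun h => by simpa using hX h
    have hlen : (rows e X l).length ≤ N := by
      rw [length_rows]
      refine le_trans (Nat.mul_le_mul_left _ ?_) hN
      simp
    have hpos : ((rows e X l).reverse ++ []) ≠ [] := by
      obtain ⟨x, X, rfl⟩ := List.exists_cons_of_ne_nil hX'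
      simp [rows_cons]
    have h := ((reaches_rowHead_cons (n := n) [] C D O he X l y).trans
      (reaches_check _ _ _ _ _ hpos))
    have h' := h.trans (by
      simpa using ih ((X.map (e · y)).reverse ++ C) (fun h => absurd h hX')
        (by rwa [length_rows] at hlen))
    have hlen' := length_rows e X (y :: l)
    simp only [List.flatMap_cons, List.reverse_append, List.append_assoc]
    refine h'.mono ?_
    simp only [List.length_append, List.length_reverse, List.length_nil, List.length_cons,
      add_mul] at hN hlen' ⊢
    omega

/-- The last entries are on top of both stacks, hence the induction from the right. By `hD` the end
of the row is recognised by peeking, which leaves the separator of the preceding row for `outRow`.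
-/
theorem reaches_outEntry (x : ι) (l : List ι) (hD : ∀ s ∈ D.head?, s = .endRow) :
    Reaches n (l.length + 1) .outEntry
      (contents A B ((l.map (e · x)).reverse ++ C) ((l.map (e x)).reverse ++ D) O) .outRow
      (contents A B C D (SchedulingSymbol.encodeNat 1 ++
        (l.flatMap fun y => SchedulingSymbol.encodeInt (deadline n (e x y) (e y x))) ++ O)) := by
  induction l using List.reverseRecOn generalizing O with
  | nil =>
    refine .of_stepAux fun v => ⟨(D.head?, v.2), ?_⟩
    rcases D with _ | ⟨s, D⟩
    · simp [program]
    · obtain rfl : s = .endRow := hD s rfl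
      simp [program]
  | append_singleton l y ih =>
    have h : Reaches n 1 .outEntry
        (contents A B (e y x :: ((l.map (e · x)).reverse ++ C))
          (e x y :: ((l.map (e x)).reverse ++ D)) O) .outEntry
        (contents A B ((l.map (e · x)).reverse ++ C) ((l.map (e x)).reverse ++ D)
          (SchedulingSymbol.encodeInt (deadline n (e x y) (e y x)) ++ O)) := by
      refine .of_stepAux fun v => ⟨(some (e x y), some (e y x)), ?_⟩
      by_cases h1 : e x y = .noArc <;> by_cases h2 : e y x = .arcA <;>
        simp [program, he, h1, h2, deadline]
    simpa [add_comm] using h.trans (ih _)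

theorem reaches_outRow (X l : List ι) :
    Reaches n (X.length * (l.length + 2)) .outRow
      (contents A B (X.flatMap fun x => l.map (e · x)).reverse (rows e X l).reverse O) .outRow
      (contents A B [] [] ((X.flatMap fun x => SchedulingSymbol.encodeNat 1 ++
        (l.flatMap fun y => SchedulingSymbol.encodeInt (deadline n (e x y) (e y x))) ++
          [.endRow]) ++ O)) := by
  induction X using List.reverseRecOn generalizing O with
  | nil => simpa using Reaches.refl _ _
  | append_singleton X x ih =>
    have h (C D : List RGPSymbol) : Reaches n 1 .outRow (contents A B C (.endRow :: D) O) .outEntry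
        (contents A B C D (.endRow :: O)) :=
      .of_stepAux fun v => ⟨(some .endRow, v.2), by simp [program]⟩
    -- Beneath the entries of row `x` lies the separator of the preceding row, or nothing if `x` is
    -- the first row.
    have hD : ∀ s ∈ (rows e X l).reverse.head?, s = .endRow := by
      rcases List.eq_nil_or_concat X with rfl | ⟨X, x, rfl⟩
      · simp
      · simp [rows_concat]
    have h' := ((h _ _).trans (reaches_outEntry A B (X.flatMap fun x => l.map (e · x)).reverse _ _
      he x l hD)).trans (ih _)
    simp only [rows_concat, List.reverse_append, List.append_assoc, List.flatMap_append,
      List.flatMap_cons, List.flatMap_nil, List.append_nil, List.reverse_cons, List.reverse_nil,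
      List.nil_append, List.cons_append, List.length_append, List.length_cons,
      List.length_nil] at h' ⊢
    refine h'.mono ?_
    simp only [add_mul]
    omega

/-- The machine computes the encoding of the scheduling instance from the matrix. -/
theorem reaches_of_rows (l : List ι) (N : ℕ) (hN : l.length * (l.length + 1) ≤ N) :
    Reaches n (10 * (N + 1) ^ 2) .copy (contents (rows e l l) [] [] [] []) .outRow
      (contents [] [] [] [] (l.flatMap fun x => SchedulingSymbol.encodeNat 1 ++
        (l.flatMap fun y => SchedulingSymbol.encodeInt (deadline n (e x y) (e y x))) ++
          [.endRow])) := by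
  have h1 := reaches_copy (n := n) (rows e l l) [] [] [] []
  have h2 := reaches_back (n := n) [] ((rows e l l).reverse ++ []) [] ((rows e l l).reverse ++ []) []
  have h3 := reaches_transpose (n := n) [] ((rows e l l).reverse ++ []) [] he l l id N hN
  have h4 := reaches_outRow (n := n) [] [] [] he l l
  simp only [List.append_nil, List.reverse_reverse] at h1 h2 h3 h4
  refine (((h1.trans h2).trans h3).trans h4).mono ?_
  simp only [List.length_reverse, length_rows]
  -- With `l.length ≤ N` and `l.length * (l.length + 1) ≤ N`, the four phases take at most `2 * N ^
  -- 2 + 7 * N + 4` steps; the constant `10` is generous.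
  have hl : l.length ≤ N := le_trans (Nat.le_mul_of_pos_right _ (Nat.succ_pos _)) hN
  have := Nat.mul_le_mul_right (2 * N + 2) hl
  nlinarith

end matrix

/-! ### The complete machine and its running time -/

/-- The machine computing the reduction. -/
def machine (n : ℕ) : FinTM2 where
  K := Stack
  k₀ := .inp
  k₁ := .out
  Γ := Alphabet
  Λ := Label
  main := .copy
  σ := Reg
  initialState := (none, none)
  Γk₀Fin := inferInstanceAs (Fintype RGPSymbol)
  m := program n

theorem encode_toScheduling {α : Type} {a : α} (n : ℕ) (I : RGPInstance a) :
    (I.toScheduling n).encode = SchedulingSymbol.encodeNat (n + 1) ++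
      (List.finRange I.m).flatMap fun x => SchedulingSymbol.encodeNat 1 ++
        ((List.finRange I.m).flatMap fun y =>
          SchedulingSymbol.encodeInt (deadline n (I.entry x y) (I.entry y x))) ++ [.endRow] :=
  rfl

theorem exists_iterate_step_eq {α : Type} {a : α} (n : ℕ) (I : RGPInstance a) :
    ∃ k ≤ 10 * (I.encode.length + 1) ^ 2 + 1,
      (flip bind (machine n).step)^[k] (some (initList (machine n) I.encode)) =
        some (haltList (machine n) (I.toScheduling n).encode) := by
  obtain ⟨v, k, hk, h⟩ := reaches_of_rows (n := n) I.entry_ne_endRow (List.finRange I.m)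
    I.encode.length (by simp [I.length_encode]) (none, none)
  -- The extra step is the last visit to `outRow`: with `row` empty, it writes `tMax` in front of
  -- the rows and resets the registers, as `haltList` requires.
  refine ⟨1 + k, by omega, ?_⟩
  have h0 : initList (machine n) I.encode =
      ⟨some .copy, (none, none), contents I.encode [] [] [] []⟩ := by
    unfold initList
    congr 1
    funext k
    cases k <;> rfl
  have h1 : haltList (machine n) (I.toScheduling n).encode =
      ⟨none, (none, none), contents [] [] [] [] (I.toScheduling n).encode⟩ := by
    unfold haltList
    congr 1
    funext k
    cases k <;> rfl
  rw [h0, h1, Function.iterate_add_apply]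
  refine (congrArg _ h).trans ?_
  change some (stepAux (program n .outRow) v _) = _
  simp [program, encode_toScheduling]
  rfl

/-- The reduction is computed in polynomial time. -/
noncomputable def computable {α : Type} (a : α) (n : ℕ) :
    TM2ComputableInPolyTime (RGPInstance.encode : RGPInstance a → _) SchedulingInstance.encode
      (RGPInstance.toScheduling n) where
  tm := machine n
  inputAlphabet := Equiv.refl RGPSymbol
  outputAlphabet := Equiv.refl SchedulingSymbol
  time := 10 * (.X + 1) ^ 2 + 1
  outputsFun I := by
    have h := exists_iterate_step_eq n I
    refine ⟨⟨h.choose, ?_⟩, ?_⟩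
    · have h2 := h.choose_spec.2
      have hid : ∀ {β : Type} (l : List β), l.map (Equiv.refl β).invFun = l := fun l => List.map_id l
      exact (congrArg (fun l => (flip bind (machine n).step)^[h.choose]
        (some (initList (machine n) l))) (hid I.encode)).trans
        (h2.trans (congrArg (fun l => some (haltList (machine n) l)) (hid _).symm))
    · simpa using h.choose_spec.1

end ReductionMachine

theorem mainTheorem9 {α : Type} (a : α) {W : Type*} (Q : RGP α W)
    (hpath : Q.digraph.IsDirectedPath) (hlabels : Q.LabelsEqA a) :
    (RGPHomProblem a Q).PolyTimeReducible SchedulingProblem := by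
  obtain ⟨n, q, hq⟩ := hpath
  exact ⟨RGPInstance.toScheduling n, ⟨ReductionMachine.computable a n⟩,
    fun I => I.nHom_iff_feasible hlabels hq⟩
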